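/- Let $P$ be a finite set (of qubits), let $V=\mathbb F_2\oplus\mathbb F_2$ with standard base $(z,x)$ and its symplectic form $\omega$, and equip $V^P$ with the sum of the forms $\omega$ over the factors. For $S\subset P$ identify $V^S$ with the vectors of $V^P$ that vanish outside $S$, and for a subspace $L\subset V^P$ put $L_S=L\cap V^S$; say that $L$ splits off $L_S$ if $L=L_S\times L_{P\setminus S}$ (the case $S=P$ is allowed). A factor $L_S$ with $S\neq\emptyset$ is a zero factor if $L_S=0$; it is a Bell Lagrangian if $|S|=2$ and $L_S$ is a Lagrangian subspace of $V^S$ (isotropic of dimension $2$) which is indecomposable, that is, $L_S\neq L_T\times L_{S\setminus T}$ for all $T\subset S$ with $\emptyset\neq T\neq S$. The Pauli group $\tilde V^P$ consists of all operators $\lambda\bigotimes_{s\in P}E(v_s)$ on $(\mathbb C^2)^{\otimes P}$ with $|\lambda|=1$ and $v\in V^P$, where $E(0)=1$, $E(z)=Z$, $E(x)=X$, $E(z+x)=Y$; it projects to $V^P$ by sending this operator to $v$. Let $L\subset V^P$ be an isotropic subspace. For a homomorphic section $\sigma\colon L\to\tilde V^P$ of this projection over $L$ let $C(L,\sigma)\subset(\mathbb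 C^2)^{\otimes P}$ be the common fixed space of the operators in $\sigma(L)$. Identify $U(2)/S^1=SO(3)$ by conjugation on the traceless Hermitian $2\times2$ matrices with base $X,Y,Z$, and let $$A(L,\sigma)=\Bigl\{g\in SO(3)^P \;\Big|\; \bigl(\textstyle\bigotimes_{s}\tilde g_s\bigr)\,C(L,\sigma)\subset C(L,\sigma)\text{ for some }\tilde g\in U(2)^P\text{ representing }g\Bigr\}.$$ For $p\in P$ let $A(L,\sigma)_p\subset SO(3)$ be the projection of $A(L,\sigma)$ to the $p$-th factor. The octahedral group is the subgroup of $SO(3)$ generated by the rotations by a right angle around the $x$, $y$ and $z$ axes; for $a\in\{x,y,z\}$ the infinite dihedral group $D_a\subset SO(3)$ is generated by all rotations around the $a$ axis and one rotation by $180$ degrees around an orthogonal coordinate axis. **Theorem.** Let $L\subset V^P$ be an isotropic subspace that splits off neither a zero factor nor a Bell Lagrangian. Then for each $p\in P$ at least one of the following statements is true: 1. $A(L,\sigma)_p$ is contained in the octahedral group for every section $\sigma$ over $L$; 2. there is an $a\in\{x,y,z\}$ such that $A(L,\sigma)_p$ is contained in the dihedral group $D_a$ for every section $\sigma$ over $L$.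 -/

import Mathlib

open scoped TensorProduct

namespace StabilizerCode

/-- The symplectic plane `V = 𝔽₂ ⊕ 𝔽₂`; the standard base is `z = (1, 0)`, `x = (0, 1)`. -/
abbrev V : Type := ZMod 2 × ZMod 2

section Symplectic

variable {P : Type*} [Fintype P] [DecidableEq P]

/-- The symplectic form on `V ^ P` (in characteristic two, so the sign is immaterial). -/
def omega (v w : P → V) : ZMod 2 :=
  ∑ s, ((v s).1 * (w s).2 - (v s).2 * (w s).1)

/-- The form `omega` vanishes identically on `L × L`. -/
def IsIsotropic (L : Submodule (ZMod 2) (P → V)) : Prop :=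
  ∀ v ∈ L, ∀ w ∈ L, omega v w = 0

/-- `V ^ S` as the subspace of `V ^ P` of the vectors that vanish outside `S`. -/
def coordSubspace (S : Finset P) : Submodule (ZMod 2) (P → V) where
  carrier := {v | ∀ p, p ∉ S → v p = 0}
  add_mem' := by
    intro v w hv hw p hp
    simp [hv p hp, hw p hp]
  zero_mem' := by
    intro p _
    rfl
  smul_mem' := by
    intro c v hv p hp
    simp [hv p hp]

/-- `L_S = L ∩ V ^ S`. -/
def restrict (L : Submodule (ZMod 2) (P → V)) (S : Finset P) :
    Submodule (ZMod 2) (P → V) :=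
  L ⊓ coordSubspace S

/-- `L` splits as the direct product `L_S × L_{P ∖ S}`. -/
def SplitsAt (L : Submodule (ZMod 2) (P → V)) (S : Finset P) : Prop :=
  L = restrict L S ⊔ restrict L Sᶜ

/-- `L` splits off a zero factor: `L = L_S × L_{P ∖ S}` with `S ≠ ∅` and `L_S = 0`
(the case `S = P`, `L = 0` included). -/
def SplitsOffZero (L : Submodule (ZMod 2) (P → V)) : Prop :=
  ∃ S : Finset P, S.Nonempty ∧ SplitsAt L S ∧ restrict L S = ⊥

/-- `M` is a Lagrangian subspace of `V ^ S`. -/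
def IsLagrangianOn (S : Finset P) (M : Submodule (ZMod 2) (P → V)) : Prop :=
  M ≤ coordSubspace S ∧ IsIsotropic M ∧ Module.finrank (ZMod 2) M = S.card

/-- `M`, a subspace of `V ^ S`, is indecomposable: `M ≠ M_T × M_{S ∖ T}` for all
`T ⊆ S` with `∅ ≠ T ≠ S`. -/
def IsIndecomposableOn (S : Finset P) (M : Submodule (ZMod 2) (P → V)) : Prop :=
  ∀ T ⊆ S, T.Nonempty → T ≠ S → M ≠ restrict M T ⊔ restrict M (S \ T)

/-- `M` is a Bell Lagrangian on `S`: an indecomposable Lagrangian in `V ^ S`, `|S| = 2`. -/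
def IsBellOn (S : Finset P) (M : Submodule (ZMod 2) (P → V)) : Prop :=
  S.card = 2 ∧ IsLagrangianOn S M ∧ IsIndecomposableOn S M

/-- `L` splits off a Bell Lagrangian. -/
def SplitsOffBell (L : Submodule (ZMod 2) (P → V)) : Prop :=
  ∃ S : Finset P, SplitsAt L S ∧ IsBellOn S (restrict L S)

end Symplectic

section Operators

/-- The three Pauli matrices `X, Y, Z`, indexed by the coordinate axes `x, y, z` of `ℝ³`. -/
def sigma : Fin 3 → Matrix (Fin 2) (Fin 2) ℂ :=
  ![!![0, 1; 1, 0], !![0, -Complex.I; Complex.I, 0], !![1, 0; 0, -1]]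

/-- The Pauli matrix of a vector of `V`: `0 ↦ 1`, `z ↦ Z`, `x ↦ X`, `z + x ↦ Y`. -/
def pauli (v : V) : Matrix (Fin 2) (Fin 2) ℂ :=
  if v = (0, 0) then 1 else if v = (1, 0) then sigma 2
  else if v = (0, 1) then sigma 0 else sigma 1

/-- The state space `(ℂ²)^{⊗ P}`. -/
abbrev StateSpace (P : Type*) : Type _ := ⨂[ℂ] _ : P, (Fin 2 → ℂ)

/-- The operator `⨂ₛ Aₛ` on the state space. -/
noncomputable def localOp {P : Type*} (A : P → Matrix (Fin 2) (Fin 2) ℂ) :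
    Module.End ℂ (StateSpace P) :=
  PiTensorProduct.map fun s => Matrix.toLin' (A s)

/-- `T` is an element of the Pauli group that projects to `v ∈ V ^ P`: a product of the
tensor product of Pauli matrices given by `v` with a scalar of modulus one. -/
def IsPauliOver {P : Type*} (v : P → V) (T : Module.End ℂ (StateSpace P)) : Prop :=
  ∃ c : Circle, T = (c : ℂ) • localOp fun s => pauli (v s)

/-- A homomorphic section over `L` of the projection from the Pauli group to `V ^ P`. -/
structure StabSection {P : Type*} (L : Submodule (ZMod 2) (P → V)) where
  /-- the underlying homomorphism -/
  hom : Multiplicative L →* Module.End ℂ (StateSpace P)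
  isPauliOver : ∀ v : L, IsPauliOver (v : P → V) (hom (Multiplicative.ofAdd v))

/-- The stabilizer code `C(L, σ)`: the common fixed space of the stabilizer group `σ(L)`. -/
noncomputable def code {P : Type*} {L : Submodule (ZMod 2) (P → V)} (σ : StabSection L) :
    Submodule ℂ (StateSpace P) :=
  ⨅ v : Multiplicative L, LinearMap.ker (σ.hom v - 1)

/-- The rotation group `SO(3)`. -/
abbrev SO3 : Type := Matrix.specialOrthogonalGroup (Fin 3) ℝ

/-- The traceless Hermitian operator `r₀ X + r₁ Y + r₂ Z`. -/
noncomputable def herm (r : Fin 3 → ℝ) : Matrix (Fin 2) (Fin 2) ℂ :=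
  ∑ i, (r i : ℂ) • sigma i

/-- `u ∈ U(2)` represents `R ∈ SO(3) = U(2) / S¹`: conjugation by `u` on the traceless
Hermitian operators is `R`. -/
def Represents (u : Matrix.unitaryGroup (Fin 2) ℂ) (R : SO3) : Prop :=
  ∀ r : Fin 3 → ℝ, (u : Matrix (Fin 2) (Fin 2) ℂ) * herm r * star (u : Matrix (Fin 2) (Fin 2) ℂ)
    = herm ((R : Matrix (Fin 3) (Fin 3) ℝ).mulVec r)

theorem Represents.one : Represents 1 1 := by
  intro r
  simp

theorem Represents.mul {u w : Matrix.unitaryGroup (Fin 2) ℂ} {R T : SO3}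
    (hu : Represents u R) (hw : Represents w T) : Represents (u * w) (R * T) := by
  intro r
  have h := hu ((T : Matrix (Fin 3) (Fin 3) ℝ).mulVec r)
  rw [← hw r] at h
  simpa [Matrix.mul_assoc, Matrix.mulVec_mulVec] using h

theorem Represents.inv {u : Matrix.unitaryGroup (Fin 2) ℂ} {R : SO3}
    (hu : Represents u R) : Represents u⁻¹ R⁻¹ := by
  intro r
  have h := hu (((R⁻¹ : SO3) : Matrix (Fin 3) (Fin 3) ℝ).mulVec r)
  have hR : (R : Matrix (Fin 3) (Fin 3) ℝ) * ((R⁻¹ : SO3) : Matrix (Fin 3) (Fin 3) ℝ) =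
      1 :=
    congrArg Subtype.val (mul_inv_cancel R)
  rw [Matrix.mulVec_mulVec, hR, Matrix.one_mulVec] at h
  rw [← h]
  have h1 : star (u : Matrix (Fin 2) (Fin 2) ℂ) * u = 1 := Matrix.UnitaryGroup.star_mul_self u
  have h2 : ((u⁻¹ : Matrix.unitaryGroup (Fin 2) ℂ) : Matrix (Fin 2) (Fin 2) ℂ)
      = star (u : Matrix (Fin 2) (Fin 2) ℂ) := rfl
  rw [h2, star_star]
  calc _ = (star (u : Matrix (Fin 2) (Fin 2) ℂ) * u) * herm (((R⁻¹ : SO3) : Matrix (Fin 3) (Fin 3) ℝ).mulVec r) *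
        (star (u : Matrix (Fin 2) (Fin 2) ℂ) * u) := by simp only [Matrix.mul_assoc]
    _ = _ := by rw [h1, Matrix.one_mul, Matrix.mul_one]

theorem localOp_one {P : Type*} : localOp (fun _ : P => 1) = 1 := by
  simp only [localOp, Matrix.toLin'_one]
  exact PiTensorProduct.map_id

theorem localOp_mul {P : Type*} (A B : P → Matrix (Fin 2) (Fin 2) ℂ) :
    localOp (fun s => A s * B s) = localOp A * localOp B := by
  simp only [localOp, Matrix.toLin'_mul]
  exact PiTensorProduct.map_comp _ _

variable {P : Type*} [Fintype P]

/-- The local unitary operator `⨂ₛ uₛ` sends the code into itself. -/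
def Preserves {L : Submodule (ZMod 2) (P → V)} (σ : StabSection L)
    (u : P → Matrix.unitaryGroup (Fin 2) ℂ) : Prop :=
  ∀ ψ ∈ code σ, localOp (fun s => (u s : Matrix (Fin 2) (Fin 2) ℂ)) ψ ∈ code σ

theorem Preserves.inv {L : Submodule (ZMod 2) (P → V)} {σ : StabSection L}
    {u : P → Matrix.unitaryGroup (Fin 2) ℂ} (h : Preserves σ u) : Preserves σ u⁻¹ := by
  set T := localOp (fun s => (u s : Matrix (Fin 2) (Fin 2) ℂ)) with hT
  set T' := localOp (fun s => ((u⁻¹) s : Matrix (Fin 2) (Fin 2) ℂ)) with hT'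
  have hl : T' * T = 1 := by
    rw [hT, hT', ← localOp_mul, ← localOp_one]
    congr 1
    funext s
    exact Matrix.UnitaryGroup.star_mul_self (u s)
  have hli : ∀ ψ, T' (T ψ) = ψ := fun ψ => by
    have := LinearMap.congr_fun hl ψ
    simpa using this
  have hinj : Function.Injective (T.restrict h) := by
    intro a b hab
    apply Subtype.ext
    rw [← hli a, ← hli b]
    exact congrArg T' (congrArg Subtype.val hab)
  have hsurj : Function.Surjective (T.restrict h) :=
    LinearMap.injective_iff_surjective (V := code σ).1 hinj
  intro ψ hψ
  obtain ⟨φ, hφ⟩ := hsurj ⟨ψ, hψ⟩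
  have : ψ = T φ := (congrArg Subtype.val hφ).symm
  rw [this]
  change T' (T φ) ∈ code σ
  rw [hli]
  exact φ.2

/-- The automorphism group `A(L, σ) ⊆ SO(3) ^ P` of the code. -/
def autGroup {L : Submodule (ZMod 2) (P → V)} (σ : StabSection L) : Subgroup (P → SO3) where
  carrier := {g | ∃ u : P → Matrix.unitaryGroup (Fin 2) ℂ,
    (∀ s, Represents (u s) (g s)) ∧ Preserves σ u}
  mul_mem' := by
    rintro g h ⟨u, hu, hu'⟩ ⟨w, hw, hw'⟩
    refine ⟨u * w, fun s => (hu s).mul (hw s), fun ψ hψ => ?_⟩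
    have := hu' _ (hw' ψ hψ)
    rw [← Module.End.mul_apply, ← localOp_mul] at this
    exact this
  one_mem' := by
    refine ⟨1, fun s => Represents.one, fun ψ hψ => ?_⟩
    have : localOp (fun s : P => ((1 : P → Matrix.unitaryGroup (Fin 2) ℂ) s :
        Matrix (Fin 2) (Fin 2) ℂ)) = 1 := localOp_one
    rw [this]
    exact hψ
  inv_mem' := by
    rintro g ⟨u, hu, hu'⟩
    exact ⟨u⁻¹, fun s => (hu s).inv, hu'.inv⟩

/-- The automorphism group at the qubit `p`: the projection of `A(L, σ)` to the `p`-th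
factor `SO(3)`. -/
def autGroupAt {L : Submodule (ZMod 2) (P → V)} (σ : StabSection L) (p : P) : Subgroup SO3 :=
  (autGroup σ).map (Pi.evalMonoidHom (fun _ : P => SO3) p)

end Operators

section Rotations

/-- The matrix of the rotation by the angle `θ` around the coordinate axis `a`
(`0, 1, 2` stand for `x, y, z`). -/
noncomputable def rotMatrix (a : Fin 3) (θ : ℝ) : Matrix (Fin 3) (Fin 3) ℝ :=
  ![!![1, 0, 0; 0, Real.cos θ, -Real.sin θ; 0, Real.sin θ, Real.cos θ],
    !![Real.cos θ, 0, Real.sin θ; 0, 1, 0; -Real.sin θ, 0, Real.cos θ],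
    !![Real.cos θ, -Real.sin θ, 0; Real.sin θ, Real.cos θ, 0; 0, 0, 1]] a

theorem rotMatrix_mem (a : Fin 3) (θ : ℝ) :
    rotMatrix a θ ∈ Matrix.specialOrthogonalGroup (Fin 3) ℝ := by
  have h := Real.sin_sq_add_cos_sq θ
  rw [Matrix.mem_specialOrthogonalGroup_iff, Matrix.mem_orthogonalGroup_iff]
  constructor
  · ext i j
    fin_cases a <;> fin_cases i <;> fin_cases j <;>
      simp [rotMatrix, Matrix.mul_apply, Fin.sum_univ_three] <;>
      nlinarith
  · fin_cases a <;> simp [rotMatrix, Matrix.det_fin_three] <;> nlinarith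

/-- The rotation by the angle `θ` around the coordinate axis `a`. -/
noncomputable def rot (a : Fin 3) (θ : ℝ) : SO3 := ⟨rotMatrix a θ, rotMatrix_mem a θ⟩

/-- The octahedral group, generated by the rotations by a right angle around the
coordinate axes. -/
noncomputable def octahedralGroup : Subgroup SO3 :=
  Subgroup.closure (Set.range fun a : Fin 3 => rot a (Real.pi / 2))

/-- The infinite dihedral group `D_a`, generated by all rotations around the axis `a` and
the rotation by 180 degrees around the next coordinate axis (in cyclic order), which is
orthogonal to `a`. -/
noncomputable def dihedralGroup (a : Fin 3) : Subgroup SO3 :=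
  Subgroup.closure (Set.range (rot a) ∪ {rot (a + 1) Real.pi})

end Rotations

end StabilizerCode

/-!
The projector onto the code is the average of the stabilizer operators, so its coefficients `c`
with respect to the Pauli products are nonzero exactly on `L`. A local automorphism commutes with
the projector; hence if `1 ⊕ gₛ` denotes the rotation `gₛ` acting on the span of `1, X, Y, Z`, then
`⨂ₛ (1 ⊕ gₛ)` fixes `c`. Moving the orthogonal factor at `p` to the other side gives

  `∑_{v p = b p} c v ∏_{s ≠ p} (1 ⊕ gₛ) (b s) (v s) = ∑_β (1 ⊕ g_p) β (b p) c (update b p β)`,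

where a product can only be nonzero if `b` and `v` have the same support.

Choose `v ∈ L` with minimal support `S` among the vectors with `v p ≠ 0`. If all vectors of `L`
with support `S` agree at `p`, the identity at `b = update v p γ` has left side zero for `γ ≠ v p`
and right side `g_p (v p) γ * c v`, so `g_p` preserves the axis `v p` up to sign. Otherwise `L_S`
projects bijectively to every factor in `S`. For `w ∈ L_S` and `b ∈ V ^ S` with `b p = w p`, only
`v = w` contributes on the left. If `g_p (v p) (w p) ≠ 0`, taking `b` equal to `v ∈ L_S` off `p`
shows that `gₛ (v s) (w s) ≠ 0` for all `s ≠ p`. Were this also true for some other `v' ∈ L_S`,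
then at a `b` that agrees with `v` at one place and with `v'` at another the left side would be
nonzero, while no `update b p β` lies in `L`. So if `|S| ≥ 3`, the matrix `g_p` is monomial and thus
octahedral. Finally, two vectors of `L_S` with distinct nonzero entries on `S` pair to `|S|` modulo
two, so `|S|` is even, and if `|S| = 2`, then `L_S` is a Bell Lagrangian which splits off.
-/

namespace StabilizerCode

open Function Matrix Module

section Monomial

variable {l m n R : Type*}

/-- Every column of `M` has at most one nonzero entry. Among the rotations of `ℝ³` the matrices
with this property are those of the octahedral group. -/
def IsColumnMonomial [Zero R] (M : Matrix m n R) : Prop :=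
  ∀ ⦃i j k⦄, M i k ≠ 0 → M j k ≠ 0 → i = j

theorem IsColumnMonomial.mul [NonUnitalNonAssocSemiring R] [Fintype m] {A : Matrix l m R}
    {B : Matrix m n R} (hA : IsColumnMonomial A) (hB : IsColumnMonomial B) :
    IsColumnMonomial (A * B) := by
  intro i j k hi hj
  rw [Matrix.mul_apply] at hi hj
  obtain ⟨a, -, ha⟩ := Finset.exists_ne_zero_of_sum_ne_zero hi
  obtain ⟨b, -, hb⟩ := Finset.exists_ne_zero_of_sum_ne_zero hj
  obtain rfl := hB (right_ne_zero_of_mul ha) (right_ne_zero_of_mul hb)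
  exact hA (left_ne_zero_of_mul ha) (left_ne_zero_of_mul hb)

end Monomial

section Rotations

theorem sum_sq_column_eq_one {n : Type*} [Fintype n] [DecidableEq n] {A : Matrix n n ℝ}
    (hA : A ∈ Matrix.orthogonalGroup n ℝ) (j : n) : ∑ i, A i j ^ 2 = 1 := by
  simpa [Matrix.mul_apply, sq] using congr_fun₂ ((Matrix.mem_orthogonalGroup_iff' n ℝ).1 hA) j j

theorem sq_eq_one_iff_column_eq_zero {n : Type*} [Fintype n] [DecidableEq n] {A : Matrix n n ℝ}
    (hA : A ∈ Matrix.orthogonalGroup n ℝ) (i j : n) :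
    A i j ^ 2 = 1 ↔ ∀ k ≠ i, A k j = 0 := by
  have hsum := sum_sq_column_eq_one hA j
  rw [← Finset.add_sum_erase _ _ (Finset.mem_univ i)] at hsum
  rw [← hsum, left_eq_add, Finset.sum_eq_zero_iff_of_nonneg fun _ _ => sq_nonneg _]
  simp

namespace SO3

variable (g : SO3)

theorem mem_orthogonalGroup : g.1 ∈ Matrix.orthogonalGroup (Fin 3) ℝ :=
  (Matrix.mem_specialOrthogonalGroup_iff.1 g.2).1

theorem transpose_eq_adjugate : g.1ᵀ = g.1.adjugate := by
  have hdet : g.1.det = 1 := (Matrix.mem_specialOrthogonalGroup_iff.1 g.2).2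
  have hadj : g.1 * g.1.adjugate = 1 := by rw [Matrix.mul_adjugate, hdet, one_smul]
  exact left_inv_eq_right_inv ((Matrix.mem_orthogonalGroup_iff' _ _).1 g.mem_orthogonalGroup) hadj

theorem apply_eq_cofactor (i j : Fin 3) :
    g.1 i j = g.1 (i + 1) (j + 1) * g.1 (i + 2) (j + 2) -
      g.1 (i + 1) (j + 2) * g.1 (i + 2) (j + 1) := by
  have h := congr_fun₂ g.transpose_eq_adjugate j i
  rw [Matrix.adjugate_fin_three, Matrix.transpose_apply] at h
  rw [h]
  fin_cases i <;> fin_cases j <;> simp <;> ring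

theorem exists_eq_rot_of_apply_eq_one {a : Fin 3} (h : g.1 a a = 1) : ∃ θ, g = rot a θ := by
  have hcol := (sq_eq_one_iff_column_eq_zero g.mem_orthogonalGroup a a).1 (by rw [h, one_pow])
  have hcol₁ : g.1 (a + 1) a = 0 := hcol _ (by simp)
  have hcol₂ : g.1 (a + 2) a = 0 := hcol _ (by simp)
  have hrow₁ : g.1 a (a + 1) = 0 := by
    simpa [add_assoc, hcol₁, hcol₂] using g.apply_eq_cofactor a (a + 1)
  have hrow₂ : g.1 a (a + 2) = 0 := by
    simpa [add_assoc, hcol₁, hcol₂] using g.apply_eq_cofactor a (a + 2)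
  have hdiag : g.1 (a + 1) (a + 1) = g.1 (a + 2) (a + 2) := by
    simpa [add_assoc, h, hcol₂] using g.apply_eq_cofactor (a + 1) (a + 1)
  have hskew : g.1 (a + 1) (a + 2) = -g.1 (a + 2) (a + 1) := by
    simpa [add_assoc, h, hcol₂] using g.apply_eq_cofactor (a + 1) (a + 2)
  obtain ⟨θ, hcos, hsin⟩ : ∃ θ, Real.cos θ = g.1 (a + 2) (a + 2) ∧
      Real.sin θ = g.1 (a + 2) (a + 1) := by
    have hsq := sum_sq_column_eq_one g.mem_orthogonalGroup (a + 1)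
    rw [← Equiv.sum_comp (Equiv.addLeft a), Fin.sum_univ_three] at hsq
    obtain ⟨θ, hθ⟩ := (Complex.norm_eq_one_iff ⟨g.1 (a + 2) (a + 2), g.1 (a + 2) (a + 1)⟩).1 (by
      rw [Complex.norm_def, Complex.normSq_mk, ← sq, ← sq, ← hdiag, Real.sqrt_eq_one]
      simpa [hrow₁] using hsq)
    rw [Complex.ext_iff, Complex.exp_ofReal_mul_I_re, Complex.exp_ofReal_mul_I_im] at hθ
    exact ⟨θ, hθ⟩
  refine ⟨θ, Subtype.ext (Matrix.ext fun i j => ?_)⟩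
  fin_cases a <;> fin_cases i <;> fin_cases j <;> simp_all [rot, rotMatrix]

end SO3

theorem rot_add (a : Fin 3) (θ φ : ℝ) : rot a (θ + φ) = rot a θ * rot a φ := by
  refine Subtype.ext (Matrix.ext fun i j => ?_)
  fin_cases a <;> fin_cases i <;> fin_cases j <;>
    simp [rot, rotMatrix, Real.cos_add, Real.sin_add] <;> ring

theorem rot_intCast_mul (a : Fin 3) (n : ℤ) (θ : ℝ) : rot a (n * θ) = rot a θ ^ n := by
  simpa using map_zpow (MonoidHom.mk' (fun φ : Multiplicative ℝ => rot a φ.toAdd) fun φ ψ =>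
    rot_add a φ.toAdd ψ.toAdd) (Multiplicative.ofAdd θ) n

theorem rot_mem_dihedralGroup (a : Fin 3) (θ : ℝ) : rot a θ ∈ dihedralGroup a :=
  Subgroup.subset_closure (Or.inl ⟨θ, rfl⟩)

theorem mem_dihedralGroup_of_column {g : SO3} {a : Fin 3} (h : ∀ k ≠ a, g.1 k a = 0) :
    g ∈ dihedralGroup a := by
  rcases sq_eq_one_iff.1 ((sq_eq_one_iff_column_eq_zero g.mem_orthogonalGroup a a).2 h) with
    hpos | hneg
  · obtain ⟨θ, rfl⟩ := g.exists_eq_rot_of_apply_eq_one hpos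
    exact rot_mem_dihedralGroup a θ
  · have hflip : rot (a + 1) Real.pi ∈ dihedralGroup a := Subgroup.subset_closure (Or.inr rfl)
    have happly : (rot (a + 1) Real.pi * g).1 a a = 1 := by
      change (rotMatrix (a + 1) Real.pi * g.1) a a = 1
      rw [Matrix.mul_apply, Fintype.sum_eq_single a fun k hk => by rw [h k hk, mul_zero], hneg]
      fin_cases a <;> simp [rotMatrix]
    obtain ⟨θ, hθ⟩ := SO3.exists_eq_rot_of_apply_eq_one _ happly
    rw [← Subgroup.mul_mem_cancel_left _ hflip, hθ]
    exact rot_mem_dihedralGroup a θ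

theorem isColumnMonomial_rot_iff {a : Fin 3} {θ : ℝ} :
    IsColumnMonomial (rot a θ).1 ↔ Real.cos θ = 0 ∨ Real.sin θ = 0 := by
  refine ⟨fun h => ?_, fun h i j k => ?_⟩
  · by_contra! hne
    have := @h (a + 1) (a + 2) (a + 1)
    fin_cases a <;> simp [rot, rotMatrix, hne] at this
  · rcases h with h | h <;> fin_cases a <;> fin_cases i <;> fin_cases j <;> fin_cases k <;>
      simp [rot, rotMatrix, h]

theorem rot_mem_octahedralGroup {a : Fin 3} {θ : ℝ} (h : Real.cos θ = 0 ∨ Real.sin θ = 0) :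
    rot a θ ∈ octahedralGroup := by
  obtain ⟨n, hn⟩ : ∃ n : ℤ, n * Real.pi = 2 * θ := by
    rw [← Real.sin_eq_zero_iff, Real.sin_two_mul]
    rcases h with h | h <;> simp [h]
  rw [show θ = n * (Real.pi / 2) by linarith, rot_intCast_mul]
  exact zpow_mem (Subgroup.subset_closure (Set.mem_range_self a)) n

theorem exists_quarterTurn_mul_apply_eq_one {g : SO3} {i : Fin 3} (hi : ∀ k ≠ i, g.1 k 0 = 0) :
    ∃ b θ, (Real.cos θ = 0 ∨ Real.sin θ = 0) ∧ (rot b θ * g).1 0 0 = 1 := by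
  have hmul (b : Fin 3) (θ : ℝ) : (rot b θ * g).1 0 0 = rotMatrix b θ 0 i * g.1 i 0 := by
    change (rotMatrix b θ * g.1) 0 0 = _
    rw [Matrix.mul_apply, Fintype.sum_eq_single i fun k hk => by rw [hi k hk, mul_zero]]
  simp only [hmul]
  rcases sq_eq_one_iff.1 ((sq_eq_one_iff_column_eq_zero g.mem_orthogonalGroup i 0).2 hi) with
    h | h <;> rw [h] <;> fin_cases i
  · exact ⟨0, 0, by simp [rotMatrix]⟩
  · exact ⟨2, -(Real.pi / 2), by simp [rotMatrix]⟩
  · exact ⟨1, Real.pi / 2, by simp [rotMatrix]⟩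
  · exact ⟨2, Real.pi, by simp [rotMatrix]⟩
  · exact ⟨2, Real.pi / 2, by simp [rotMatrix]⟩
  · exact ⟨1, -(Real.pi / 2), by simp [rotMatrix]⟩

theorem mem_octahedralGroup_of_isColumnMonomial {g : SO3} (hg : IsColumnMonomial g.1) :
    g ∈ octahedralGroup := by
  obtain ⟨i, hi⟩ : ∃ i, ∀ k ≠ i, g.1 k 0 = 0 := by
    obtain ⟨i, -, hi⟩ := Finset.exists_ne_zero_of_sum_ne_zero
      ((sum_sq_column_eq_one g.mem_orthogonalGroup 0).trans_ne one_ne_zero)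
    exact ⟨i, fun k hk => by_contra fun hk' => hk (hg hk' (pow_ne_zero_iff two_ne_zero |>.1 hi))⟩
  obtain ⟨b, θ, hθ, hone⟩ := exists_quarterTurn_mul_apply_eq_one hi
  obtain ⟨φ, hφ⟩ := SO3.exists_eq_rot_of_apply_eq_one _ hone
  have hmono : IsColumnMonomial (rot 0 φ).1 := hφ ▸ (isColumnMonomial_rot_iff.2 hθ).mul hg
  rw [← Subgroup.mul_mem_cancel_left _ (rot_mem_octahedralGroup hθ), hφ]
  exact rot_mem_octahedralGroup (isColumnMonomial_rot_iff.1 hmono)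

end Rotations

section Kronecker

variable {ι R : Type*} [Fintype ι] [CommSemiring R] {l m n : ι → Type*}

/-- The Kronecker product of a finite family of matrices: the matrix of a tensor product of linear
maps with respect to the tensor products of the chosen bases. -/
def piKronecker (A : ∀ s, Matrix (m s) (n s) R) : Matrix (∀ s, m s) (∀ s, n s) R :=
  of fun i j => ∏ s, A s (i s) (j s)

theorem piKronecker_apply (A : ∀ s, Matrix (m s) (n s) R) (i : ∀ s, m s) (j : ∀ s, n s) :
    piKronecker A i j = ∏ s, A s (i s) (j s) :=
  rfl

theorem piKronecker_mul_piKronecker [DecidableEq ι] [∀ s, Fintype (m s)]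
    (A : ∀ s, Matrix (l s) (m s) R) (B : ∀ s, Matrix (m s) (n s) R) :
    piKronecker A * piKronecker B = piKronecker fun s => A s * B s := by
  ext i j
  simp only [piKronecker_apply, Matrix.mul_apply, ← Finset.prod_mul_distrib]
  rw [Finset.prod_univ_sum, Fintype.piFinset_univ]

theorem piKronecker_one [∀ s, DecidableEq (n s)] :
    piKronecker (fun s => (1 : Matrix (n s) (n s) R)) = 1 := by
  ext i j
  simp only [piKronecker_apply, Matrix.one_apply, Fintype.prod_ite_zero, Finset.prod_const_one,
    funext_iff]

theorem conjTranspose_piKronecker [StarRing R] (A : ∀ s, Matrix (m s) (n s) R) :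
    (piKronecker A)ᴴ = piKronecker fun s => (A s)ᴴ := by
  ext i j
  simp [piKronecker_apply, conjTranspose_apply]

theorem trace_piKronecker [DecidableEq ι] [∀ s, Fintype (n s)] (A : ∀ s, Matrix (n s) (n s) R) :
    (piKronecker A).trace = ∏ s, (A s).trace := by
  simp only [trace, Matrix.diag_apply, piKronecker_apply]
  rw [Finset.prod_univ_sum, Fintype.piFinset_univ]

/-- The computational basis identifies the operators on the state space with matrices. -/
noncomputable def opMatrix (P : Type*) [Fintype P] [DecidableEq P] :
    Module.End ℂ (StateSpace P) ≃ₐ[ℂ] Matrix (P → Fin 2) (P → Fin 2) ℂ :=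
  LinearMap.toMatrixAlgEquiv (Basis.piTensorProduct fun _ : P => Pi.basisFun ℂ (Fin 2))

theorem opMatrix_localOp {P : Type*} [Fintype P] [DecidableEq P]
    (A : P → Matrix (Fin 2) (Fin 2) ℂ) : opMatrix P (localOp A) = piKronecker A := by
  ext i j
  simp [opMatrix, LinearMap.toMatrixAlgEquiv_apply, Basis.piTensorProduct_apply, localOp,
    PiTensorProduct.map_tprod, Basis.piTensorProduct_repr_tprod_apply, piKronecker_apply]

end Kronecker

section Pauli

/-- The vector of `V` whose Pauli matrix is `sigma i`. -/
def axisVector : Fin 3 → V :=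
  ![(0, 1), (1, 1), (1, 0)]

theorem axisVector_injective : Function.Injective axisVector := by decide

theorem axisVector_ne_zero (i : Fin 3) : axisVector i ≠ 0 := by
  revert i
  decide

theorem exists_axisVector_eq {v : V} (hv : v ≠ 0) : ∃ i, axisVector i = v := by
  revert v
  decide

/-- The index set of the four Pauli matrices: the identity, which rotations fix, and the
coordinate axes. -/
noncomputable def unitSumAxisEquiv : Unit ⊕ Fin 3 ≃ V :=
  .ofBijective (Sum.elim 0 axisVector) (by decide)

theorem unitSumAxisEquiv_symm_zero : unitSumAxisEquiv.symm 0 = .inl () :=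
  unitSumAxisEquiv.symm_apply_eq.2 rfl

theorem unitSumAxisEquiv_symm_axisVector (i : Fin 3) :
    unitSumAxisEquiv.symm (axisVector i) = .inr i :=
  unitSumAxisEquiv.symm_apply_eq.2 rfl

/-- The matrix of the action `1 ⊕ g` of a rotation `g` on the span of the four Pauli matrices. -/
noncomputable def pauliRotation (g : SO3) : Matrix V V ℝ :=
  reindex unitSumAxisEquiv unitSumAxisEquiv (fromBlocks 1 0 0 g.1)

theorem pauliRotation_axisVector (g : SO3) (i j : Fin 3) :
    pauliRotation g (axisVector i) (axisVector j) = g.1 i j := by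
  simp [pauliRotation, unitSumAxisEquiv_symm_axisVector]

theorem pauliRotation_zero_zero (g : SO3) : pauliRotation g 0 0 = 1 := by
  simp [pauliRotation, unitSumAxisEquiv_symm_zero]

theorem pauliRotation_zero_left (g : SO3) {v : V} (hv : v ≠ 0) : pauliRotation g 0 v = 0 := by
  obtain ⟨i, rfl⟩ := exists_axisVector_eq hv
  simp [pauliRotation, unitSumAxisEquiv_symm_zero, unitSumAxisEquiv_symm_axisVector]

theorem pauliRotation_zero_right (g : SO3) {b : V} (hb : b ≠ 0) : pauliRotation g b 0 = 0 := by
  obtain ⟨i, rfl⟩ := exists_axisVector_eq hb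
  simp [pauliRotation, unitSumAxisEquiv_symm_zero, unitSumAxisEquiv_symm_axisVector]

theorem pauliRotation_eq_zero (g : SO3) {b v : V} (h : ¬(b = 0 ↔ v = 0)) :
    pauliRotation g b v = 0 := by
  obtain rfl | hb := eq_or_ne b 0
  · exact pauliRotation_zero_left g (by simpa [eq_comm] using h)
  · obtain rfl : v = 0 := by simpa [hb] using h
    exact pauliRotation_zero_right g hb

theorem pauliRotation_one : pauliRotation 1 = 1 := by
  simp [pauliRotation]

theorem transpose_pauliRotation_mul_self (g : SO3) :
    (pauliRotation g)ᵀ * pauliRotation g = 1 := by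
  have hg : g.1ᵀ * g.1 = 1 := (mem_orthogonalGroup_iff' _ _).1 g.mem_orthogonalGroup
  simp [pauliRotation, fromBlocks_transpose, fromBlocks_multiply, hg]

theorem pauli_zero : pauli 0 = 1 :=
  if_pos rfl

theorem pauli_axisVector (i : Fin 3) : pauli (axisVector i) = sigma i := by
  fin_cases i <;> rfl

theorem pauli_mul_self (v : V) : pauli v * pauli v = 1 := by
  obtain rfl | hv := eq_or_ne v 0
  · rw [pauli_zero, one_mul]
  · obtain ⟨k, rfl⟩ := exists_axisVector_eq hv
    ext i j
    fin_cases k <;> fin_cases i <;> fin_cases j <;> simp [pauli_axisVector, sigma, Matrix.mul_apply]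

theorem conjTranspose_pauli (v : V) : (pauli v)ᴴ = pauli v := by
  obtain rfl | hv := eq_or_ne v 0
  · rw [pauli_zero, conjTranspose_one]
  · obtain ⟨k, rfl⟩ := exists_axisVector_eq hv
    ext i j
    fin_cases k <;> fin_cases i <;> fin_cases j <;> simp [pauli_axisVector, sigma]

theorem trace_sigma (i : Fin 3) : (sigma i).trace = 0 := by
  fin_cases i <;> simp [sigma, trace]

theorem trace_pauli_mul_pauli (b v : V) :
    (pauli b * pauli v).trace = if b = v then 2 else 0 := by
  obtain rfl | hb := eq_or_ne b 0 <;> obtain rfl | hv := eq_or_ne v 0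
  · simp [pauli_zero]
  · obtain ⟨j, rfl⟩ := exists_axisVector_eq hv
    simp [pauli_zero, pauli_axisVector, trace_sigma, hv.symm]
  · obtain ⟨i, rfl⟩ := exists_axisVector_eq hb
    simp [pauli_zero, pauli_axisVector, trace_sigma, hb]
  · obtain ⟨i, rfl⟩ := exists_axisVector_eq hb
    obtain ⟨j, rfl⟩ := exists_axisVector_eq hv
    simp only [pauli_axisVector, axisVector_injective.eq_iff]
    fin_cases i <;> fin_cases j <;> simp [sigma, trace] <;> norm_num

theorem Represents.conj_sigma {u : Matrix.unitaryGroup (Fin 2) ℂ} {g : SO3} (h : Represents u g)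
    (i : Fin 3) : u.1 * sigma i * u.1ᴴ = ∑ k, (g.1 k i : ℂ) • sigma k := by
  simpa [herm, Pi.single_apply, star_eq_conjTranspose] using h (Pi.single i 1)

theorem Represents.conj_pauli {u : Matrix.unitaryGroup (Fin 2) ℂ} {g : SO3} (h : Represents u g)
    (v : V) : u.1 * pauli v * u.1ᴴ = ∑ b, (pauliRotation g b v : ℂ) • pauli b := by
  have huu : u.1 * u.1ᴴ = 1 := mem_unitaryGroup_iff.1 u.2
  rw [← unitSumAxisEquiv.sum_comp, Fintype.sum_sum_type]
  change _ = ∑ _, (pauliRotation g 0 v : ℂ) • pauli 0 +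
    ∑ i, (pauliRotation g (axisVector i) v : ℂ) • pauli (axisVector i)
  obtain rfl | hv := eq_or_ne v 0
  · simp [pauli_zero, huu, pauliRotation_zero_zero, pauliRotation_zero_right, axisVector_ne_zero]
  · obtain ⟨k, rfl⟩ := exists_axisVector_eq hv
    simp [pauli_axisVector, h.conj_sigma, pauliRotation_zero_left, axisVector_ne_zero,
      pauliRotation_axisVector]

theorem Represents.trace_pauli_mul_conj {u : Matrix.unitaryGroup (Fin 2) ℂ} {g : SO3}
    (h : Represents u g) (b v : V) :
    (pauli b * (u.1 * pauli v * u.1ᴴ)).trace = 2 * pauliRotation g b v := by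
  simp [h.conj_pauli, Matrix.mul_sum, trace_sum, trace_pauli_mul_pauli, mul_comm]

end Pauli

section PauliProduct

variable {P : Type*} [Fintype P]

/-- The matrix of the tensor product of Pauli operators given by `v ∈ V ^ P`. -/
def pauliProduct (v : P → V) : Matrix (P → Fin 2) (P → Fin 2) ℂ :=
  piKronecker fun s => pauli (v s)

theorem conjTranspose_pauliProduct (v : P → V) : (pauliProduct v)ᴴ = pauliProduct v := by
  simp only [pauliProduct, conjTranspose_piKronecker, conjTranspose_pauli]

variable [DecidableEq P]

theorem pauliProduct_mul_self (v : P → V) : pauliProduct v * pauliProduct v = 1 := by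
  simp only [pauliProduct, piKronecker_mul_piKronecker, pauli_mul_self, piKronecker_one]

theorem trace_pauliProduct_mul_conj {u : P → Matrix.unitaryGroup (Fin 2) ℂ} {g : P → SO3}
    (h : ∀ s, Represents (u s) (g s)) (b v : P → V) :
    (pauliProduct b * (piKronecker (fun s => (u s).1) * pauliProduct v *
      (piKronecker fun s => (u s).1)ᴴ)).trace =
      2 ^ Fintype.card P * (piKronecker (fun s => pauliRotation (g s)) b v : ℝ) := by
  simp [pauliProduct, conjTranspose_piKronecker, piKronecker_mul_piKronecker, trace_piKronecker,
    (h _).trace_pauli_mul_conj, Finset.prod_mul_distrib, piKronecker_apply]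

theorem trace_pauliProduct_mul_pauliProduct (b v : P → V) :
    (pauliProduct b * pauliProduct v).trace = 2 ^ Fintype.card P * if b = v then 1 else 0 := by
  simpa only [OneMemClass.coe_one, piKronecker_one, pauliRotation_one, Matrix.one_mul,
    conjTranspose_one, Matrix.mul_one, Matrix.one_apply, apply_ite Complex.ofReal,
    Complex.ofReal_one, Complex.ofReal_zero] using
    trace_pauliProduct_mul_conj (fun _ : P => Represents.one) b v

end PauliProduct

section Invariance

theorem commute_of_mul_mul_eq {R : Type*} [Semigroup R] [StarMul R] {p w : R}
    (hp : IsSelfAdjoint p) (hw : p * w * p = w * p) (hw' : p * star w * p = star w * p) :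
    Commute w p := by
  have h := congrArg star hw'
  simp only [star_mul, star_star, hp.star_eq, ← mul_assoc] at h
  exact hw.symm.trans h

variable {P : Type*} {L : Submodule (ZMod 2) (P → V)} (σ : StabSection L)

theorem code_eq_invariants : code σ = Representation.invariants σ.hom := by
  ext ψ
  simp [code, sub_eq_zero]

variable [Fintype P]

/-- The projector onto the code, as the average of the stabilizer operators. -/
noncomputable def StabSection.projector : Module.End ℂ (StateSpace P) :=
  letI := Fintype.ofFinite (Multiplicative L)
  letI := invertibleOfNonzero (Nat.cast_ne_zero.2 Fintype.card_ne_zero :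
    (Fintype.card (Multiplicative L) : ℂ) ≠ 0)
  Representation.averageMap σ.hom

theorem StabSection.isProj_projector : LinearMap.IsProj (code σ) σ.projector := by
  rw [code_eq_invariants]
  let := Fintype.ofFinite (Multiplicative L)
  exact Representation.isProj_averageMap _

variable [DecidableEq P]

theorem StabSection.exists_opMatrix_hom_eq (v : L) :
    ∃ ε : ℝ, ε ≠ 0 ∧
      opMatrix P (σ.hom (Multiplicative.ofAdd v)) = (ε : ℂ) • pauliProduct v.1 := by
  obtain ⟨c, hc⟩ := σ.isPauliOver v
  have hop : opMatrix P (σ.hom (Multiplicative.ofAdd v)) = (c : ℂ) • pauliProduct v.1 := by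
    rw [hc, map_smul, opMatrix_localOp, pauliProduct]
  have hsq : (c : ℂ) * c = 1 := by
    have h : σ.hom (Multiplicative.ofAdd v) * σ.hom (Multiplicative.ofAdd v) = 1 := by
      rw [← map_mul, ← ofAdd_add, ZModModule.add_self, ofAdd_zero, map_one]
    replace h := congrArg (opMatrix P) h
    rw [map_mul, map_one, hop, smul_mul_smul_comm, pauliProduct_mul_self] at h
    simpa using congr_fun₂ h 0 0
  rcases mul_self_eq_one_iff.1 hsq with h | h
  · exact ⟨1, one_ne_zero, by rw [hop, h, Complex.ofReal_one]⟩
  · exact ⟨-1, neg_ne_zero.2 one_ne_zero, by rw [hop, h, Complex.ofReal_neg, Complex.ofReal_one]⟩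

theorem StabSection.exists_opMatrix_projector_eq :
    ∃ c : (P → V) → ℝ, (∀ v, c v ≠ 0 ↔ v ∈ L) ∧
      opMatrix P σ.projector = ∑ v, (c v : ℂ) • pauliProduct v := by
  classical
  choose ε hε hop using σ.exists_opMatrix_hom_eq
  refine ⟨fun v => if h : v ∈ L then (Nat.card (Multiplicative L) : ℝ)⁻¹ * ε ⟨v, h⟩ else 0,
    fun v => ?_, ?_⟩
  · by_cases h : v ∈ L <;> simp [h, hε]
  · simp only [projector, Representation.averageMap, GroupAlgebra.average, map_smul, map_sum,
      Representation.asAlgebraHom_of, Finset.smul_sum]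
    let := Fintype.ofFinite (Multiplicative L)
    refine Fintype.sum_of_injective (fun v => v.toAdd.1)
      (Subtype.val_injective.comp Multiplicative.toAdd.injective) _ _ (fun v hv => ?_) fun v => ?_
    · have hvL : v ∉ L := fun h => hv ⟨Multiplicative.ofAdd ⟨v, h⟩, rfl⟩
      simp [hvL]
    · rw [← ofAdd_toAdd v, hop]
      simp [mul_smul, Nat.card_eq_fintype_card]

theorem StabSection.isSelfAdjoint_opMatrix_projector :
    IsSelfAdjoint (opMatrix P σ.projector) := by
  obtain ⟨c, -, hc⟩ := σ.exists_opMatrix_projector_eq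
  rw [isSelfAdjoint_iff, hc]
  simp [star_eq_conjTranspose, conjTranspose_pauliProduct]

variable {σ}

theorem Preserves.projector_mul_mul {u : P → Matrix.unitaryGroup (Fin 2) ℂ}
    (h : Preserves σ u) :
    opMatrix P σ.projector * piKronecker (fun s => (u s).1) * opMatrix P σ.projector =
      piKronecker (fun s => (u s).1) * opMatrix P σ.projector := by
  simpa only [← Module.End.mul_eq_comp, map_mul, opMatrix_localOp, mul_assoc] using
    congrArg (opMatrix P) (σ.isProj_projector.mem_invtSubmodule_iff.1 h)

theorem Preserves.commute {u : P → Matrix.unitaryGroup (Fin 2) ℂ} (h : Preserves σ u) :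
    Commute (piKronecker fun s => (u s).1) (opMatrix P σ.projector) := by
  refine commute_of_mul_mul_eq σ.isSelfAdjoint_opMatrix_projector h.projector_mul_mul ?_
  rw [star_eq_conjTranspose, conjTranspose_piKronecker]
  exact h.inv.projector_mul_mul

theorem Preserves.conj_projector {u : P → Matrix.unitaryGroup (Fin 2) ℂ} (h : Preserves σ u) :
    piKronecker (fun s => (u s).1) * opMatrix P σ.projector * (piKronecker fun s => (u s).1)ᴴ =
      opMatrix P σ.projector := by
  have huu (s : P) : (u s).1 * (u s).1ᴴ = 1 := mem_unitaryGroup_iff.1 (u s).2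
  rw [h.commute.eq, mul_assoc, conjTranspose_piKronecker, piKronecker_mul_piKronecker]
  simp only [huu, piKronecker_one, mul_one]

theorem piKronecker_pauliRotation_mulVec_eq {c : (P → V) → ℝ}
    (hc : opMatrix P σ.projector = ∑ v, (c v : ℂ) • pauliProduct v) {g : P → SO3}
    (hg : g ∈ autGroup σ) : piKronecker (fun s => pauliRotation (g s)) *ᵥ c = c := by
  obtain ⟨u, hu, hpres⟩ := hg
  funext b
  have htrace := congrArg (fun M => (pauliProduct b * M).trace) hpres.conj_projector
  simp only [hc, Matrix.mul_sum, Matrix.sum_mul, trace_sum, Matrix.mul_smul, Matrix.smul_mul,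
    trace_smul, trace_pauliProduct_mul_conj hu, trace_pauliProduct_mul_pauliProduct,
    smul_eq_mul, mul_left_comm (c _ : ℂ), ← Finset.mul_sum] at htrace
  have hsum := mul_left_cancel₀ (pow_ne_zero _ two_ne_zero) htrace
  simp only [mul_comm (c _ : ℂ), ite_mul, one_mul, zero_mul, Finset.sum_ite_eq, Finset.mem_univ,
    if_true] at hsum
  exact_mod_cast hsum

end Invariance

section Contraction

variable {ι n R : Type*} [Fintype ι] [DecidableEq ι] [Fintype n] [DecidableEq n] [CommSemiring R]

theorem piKronecker_update_one_mulVec (p : ι) (M : Matrix n n R) (c : (ι → n) → R) (b : ι → n) :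
    (piKronecker (update 1 p M) *ᵥ c) b = ∑ β, M (b p) β * c (update b p β) := by
  refine (Fintype.sum_of_injective (update b p) (update_injective b p) _ _ (fun v hv => ?_)
    fun β => ?_).symm
  · obtain ⟨s, hs⟩ := ne_iff.1 fun h : update b p (v p) = v => hv ⟨v p, h⟩
    have hsp : s ≠ p := by
      rintro rfl
      simp at hs
    rw [update_of_ne hsp] at hs
    have hentry : piKronecker (update 1 p M) b v = 0 :=
      Finset.prod_eq_zero (Finset.mem_univ s) (by
        rw [update_of_ne hsp, Pi.one_apply, one_apply_ne hs])
    exact mul_eq_zero_of_left hentry _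
  · have hentry : piKronecker (update 1 p M) b (update b p β) = M (b p) β := by
      rw [piKronecker_apply, Finset.prod_eq_single p (fun s _ hs => by simp [hs]) (by simp),
        update_self, update_self]
    exact congrArg (· * _) hentry.symm

theorem piKronecker_update_mulVec_eq {G : ι → Matrix n n R} {c : (ι → n) → R}
    (hc : piKronecker G *ᵥ c = c) {p : ι} (hG : (G p)ᵀ * G p = 1) (b : ι → n) :
    (piKronecker (update G p 1) *ᵥ c) b = ∑ β, G p β (b p) * c (update b p β) := by
  have hupdate : piKronecker (update 1 p (G p)ᵀ) * piKronecker G = piKronecker (update G p 1) := by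
    rw [piKronecker_mul_piKronecker]
    congr 1
    funext s
    obtain rfl | hs := eq_or_ne s p <;> simp [*]
  rw [← hupdate, ← mulVec_mulVec, hc, piKronecker_update_one_mulVec]
  simp only [transpose_apply]

end Contraction

section Coefficients

variable {P : Type*} [Fintype P] [DecidableEq P] {L : Submodule (ZMod 2) (P → V)}
  {p : P} {c : (P → V) → ℝ} {g : P → SO3}

/-- The action of the rotations `g` on the coefficients of Pauli products at all factors but
`p`. -/
noncomputable def pauliRotationOff (g : P → SO3) (p : P) : Matrix (P → V) (P → V) ℝ :=
  piKronecker (update (fun s => pauliRotation (g s)) p 1)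

theorem pauliRotationOff_ne_zero_iff {b v : P → V} :
    pauliRotationOff g p b v ≠ 0 ↔
      b p = v p ∧ ∀ s ≠ p, pauliRotation (g s) (b s) (v s) ≠ 0 := by
  simp only [pauliRotationOff, piKronecker_apply, Finset.prod_ne_zero_iff, Finset.mem_univ,
    true_imp_iff]
  refine ⟨fun h => ⟨?_, fun s hs => by simpa [hs] using h s⟩, fun ⟨hp, h⟩ s => ?_⟩
  · simpa [one_apply] using h p
  · obtain rfl | hs := eq_or_ne s p
    · simp [hp]
    · simpa [hs] using h s hs

theorem eq_zero_iff_of_pauliRotationOff_ne_zero {b v : P → V} (h : pauliRotationOff g p b v ≠ 0)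
    (s : P) : b s = 0 ↔ v s = 0 := by
  rw [pauliRotationOff_ne_zero_iff] at h
  obtain rfl | hs := eq_or_ne s p
  · rw [h.1]
  · exact not_not.1 (mt (pauliRotation_eq_zero (g s)) (h.2 s hs))

theorem pauliRotationOff_mulVec_eq (hc : piKronecker (fun s => pauliRotation (g s)) *ᵥ c = c)
    (p : P) (b : P → V) :
    (pauliRotationOff g p *ᵥ c) b = ∑ β, pauliRotation (g p) β (b p) * c (update b p β) :=
  piKronecker_update_mulVec_eq hc (transpose_pauliRotation_mul_self (g p)) b

theorem pauliRotation_eq_zero_of_forall_apply_eq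
    (hc : piKronecker (fun s => pauliRotation (g s)) *ᵥ c = c) (hcL : ∀ v, c v ≠ 0 ↔ v ∈ L)
    {v : P → V} (hv : v ∈ L) (hvp : v p ≠ 0)
    (hsame : ∀ w ∈ L, support w = support v → w p = v p) {γ : V} (hγ : γ ≠ v p) :
    pauliRotation (g p) (v p) γ = 0 := by
  obtain rfl | hγ0 := eq_or_ne γ 0
  · exact pauliRotation_zero_right (g p) hvp
  have hsupport {β : V} (hβ : β ≠ 0) : support (update v p β) = support v := by
    ext s
    obtain rfl | hs := eq_or_ne s p <;> simp [*]
  have hleft : (pauliRotationOff g p *ᵥ c) (update v p γ) = 0 := by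
    refine Finset.sum_eq_zero fun w _ => ?_
    by_contra! h
    obtain ⟨hM, hcw⟩ := mul_ne_zero_iff.1 h
    refine hγ ?_
    rw [← hsame w ((hcL w).1 hcw), ← (pauliRotationOff_ne_zero_iff.1 hM).1, update_self]
    rw [← hsupport hγ0]
    ext s
    exact (eq_zero_iff_of_pauliRotationOff_ne_zero hM s).not.symm
  rw [pauliRotationOff_mulVec_eq hc, update_self, Finset.sum_eq_single (v p) _ (by simp),
    update_idem, update_eq_self] at hleft
  · exact (mul_eq_zero.1 hleft).resolve_right ((hcL v).2 hv)
  · intro β _ hβ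
    obtain rfl | hβ0 := eq_or_ne β 0
    · rw [pauliRotation_zero_left _ hγ0, zero_mul]
    · have hβL : c (update v p β) = 0 := by
        by_contra h
        exact hβ (by simpa using hsame _ ((hcL _).1 h) (hsupport hβ0))
      rw [update_idem, hβL, mul_zero]

end Coefficients

section Diagonal

variable {P : Type*} {L : Submodule (ZMod 2) (P → V)} {S : Finset P}

theorem update_mem_coordSubspace [DecidableEq P] {b : P → V} (hb : b ∈ coordSubspace S) {p : P}
    (hp : p ∈ S) (β : V) : update b p β ∈ coordSubspace S := fun s hs => by
  rw [update_of_ne (ne_of_mem_of_not_mem hp hs).symm, hb s hs]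

/-- `L_S` projects bijectively onto each factor `V` of `V ^ S`: up to isomorphisms of the factors,
it is the diagonal of `V ^ S`. -/
def IsDiagonalOn (L : Submodule (ZMod 2) (P → V)) (S : Finset P) : Prop :=
  ∀ s ∈ S, Bijective fun u : restrict L S => u.1 s

namespace IsDiagonalOn

variable {s : P} {u v w : P → V}

theorem eq_of_apply_eq (h : IsDiagonalOn L S) (hs : s ∈ S) (hu : u ∈ restrict L S)
    (hv : v ∈ restrict L S) (huv : u s = v s) : u = v :=
  congrArg Subtype.val ((h s hs).injective (a₁ := ⟨u, hu⟩) (a₂ := ⟨v, hv⟩) huv)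

theorem exists_apply_eq (h : IsDiagonalOn L S) (hs : s ∈ S) (α : V) :
    ∃ u ∈ restrict L S, u s = α :=
  let ⟨u, hu⟩ := (h s hs).surjective α
  ⟨u.1, u.2, hu⟩

theorem apply_ne_zero (h : IsDiagonalOn L S) (hu : u ∈ restrict L S) (hu0 : u ≠ 0) (hs : s ∈ S) :
    u s ≠ 0 :=
  fun hus => hu0 (h.eq_of_apply_eq hs hu (zero_mem _) hus)

variable [Fintype P] [DecidableEq P] {p q r : P} {c : (P → V) → ℝ} {g : P → SO3}

theorem pauliRotationOff_mulVec (h : IsDiagonalOn L S) (hcL : ∀ v, c v ≠ 0 ↔ v ∈ L)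
    (hp : p ∈ S) (hw : w ∈ restrict L S) {b : P → V} (hb : b ∈ coordSubspace S)
    (hbw : b p = w p) :
    (pauliRotationOff g p *ᵥ c) b = pauliRotationOff g p b w * c w := by
  refine Finset.sum_eq_single w (fun u _ hu => ?_) (by simp)
  by_contra! hne
  obtain ⟨hM, hcu⟩ := mul_ne_zero_iff.1 hne
  have huS : u ∈ restrict L S := ⟨(hcL u).1 hcu, fun s hs =>
    (eq_zero_iff_of_pauliRotationOff_ne_zero hM s).1 (hb s hs)⟩
  exact hu (h.eq_of_apply_eq hp huS hw ((pauliRotationOff_ne_zero_iff.1 hM).1.symm.trans hbw))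

theorem pauliRotation_ne_zero (h : IsDiagonalOn L S)
    (hc : piKronecker (fun s => pauliRotation (g s)) *ᵥ c = c) (hcL : ∀ v, c v ≠ 0 ↔ v ∈ L)
    (hp : p ∈ S) (hq : q ∈ S) (hqp : q ≠ p) (hv : v ∈ restrict L S) (hw : w ∈ restrict L S)
    (hvw : pauliRotation (g p) (v p) (w p) ≠ 0) {s : P} (hsp : s ≠ p) :
    pauliRotation (g s) (v s) (w s) ≠ 0 := by
  have hb := update_mem_coordSubspace hv.2 hp (w p)
  have hentry := h.pauliRotationOff_mulVec (g := g) hcL hp hw hb (update_self ..)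
  rw [pauliRotationOff_mulVec_eq hc, update_self, Finset.sum_eq_single (v p) _ (by simp),
    update_idem, update_eq_self] at hentry
  · have hne := left_ne_zero_of_mul (hentry ▸ mul_ne_zero hvw ((hcL v).2 hv.1))
    simpa [hsp] using (pauliRotationOff_ne_zero_iff.1 hne).2 s hsp
  · intro β _ hβ
    have hβL : c (update v p β) = 0 := by
      by_contra hβL
      have hu : update v p β ∈ restrict L S :=
        ⟨(hcL _).1 hβL, update_mem_coordSubspace hv.2 hp β⟩
      exact hβ (by rw [← h.eq_of_apply_eq hq hu hv (update_of_ne hqp ..), update_self])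
    rw [update_idem, hβL, mul_zero]

theorem eq_of_pauliRotation_ne_zero (h : IsDiagonalOn L S)
    (hc : piKronecker (fun s => pauliRotation (g s)) *ᵥ c = c) (hcL : ∀ v, c v ≠ 0 ↔ v ∈ L)
    (hp : p ∈ S) (hq : q ∈ S) (hr : r ∈ S) (hqp : q ≠ p) (hrp : r ≠ p) (hqr : q ≠ r)
    {v' : P → V} (hv : v ∈ restrict L S) (hv' : v' ∈ restrict L S) (hw : w ∈ restrict L S)
    (hvw : pauliRotation (g p) (v p) (w p) ≠ 0) (hvw' : pauliRotation (g p) (v' p) (w p) ≠ 0) :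
    v = v' := by
  set b := update (update v q (v' q)) p (w p) with hb
  have hbS : b ∈ coordSubspace S :=
    update_mem_coordSubspace (update_mem_coordSubspace hv.2 hq _) hp _
  have hM : pauliRotationOff g p b w ≠ 0 := by
    refine pauliRotationOff_ne_zero_iff.2 ⟨update_self .., fun s hs => ?_⟩
    obtain rfl | hsq := eq_or_ne s q
    · simpa [hb, hs] using h.pauliRotation_ne_zero hc hcL hp hr hrp hv' hw hvw' hs
    · simpa [hb, hs, hsq] using h.pauliRotation_ne_zero hc hcL hp hr hrp hv hw hvw hs
  have hsum := mul_ne_zero hM ((hcL w).2 hw.1)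
  rw [← h.pauliRotationOff_mulVec hcL hp hw hbS (update_self ..),
    pauliRotationOff_mulVec_eq hc] at hsum
  obtain ⟨β, -, hβ⟩ := Finset.exists_ne_zero_of_sum_ne_zero hsum
  have hu : update b p β ∈ restrict L S :=
    ⟨(hcL _).1 (right_ne_zero_of_mul hβ), update_mem_coordSubspace hbS hp β⟩
  trans update b p β
  · exact h.eq_of_apply_eq hr hv hu (by simp [hb, hrp, hqr.symm])
  · exact h.eq_of_apply_eq hq hu hv' (by simp [hb, hqp])

end IsDiagonalOn

end Diagonal

section Automorphisms

variable {P : Type*} [Fintype P] {L : Submodule (ZMod 2) (P → V)} {S : Finset P} {p : P}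

theorem autGroupAt_le_dihedralGroup {v : P → V} (hv : v ∈ L) {a : Fin 3} (hva : axisVector a = v p)
    (hsame : ∀ w ∈ L, support w = support v → w p = v p) (σ : StabSection L) :
    autGroupAt σ p ≤ dihedralGroup a := by
  classical
  rintro _ ⟨g, hg, rfl⟩
  obtain ⟨c, hcL, hσ⟩ := σ.exists_opMatrix_projector_eq
  have hc := piKronecker_pauliRotation_mulVec_eq hσ hg
  refine inv_mem_iff.1 (mem_dihedralGroup_of_column fun k hk => ?_)
  change (g p).1 a k = 0
  rw [← pauliRotation_axisVector, hva]
  refine pauliRotation_eq_zero_of_forall_apply_eq hc hcL hv (hva ▸ axisVector_ne_zero a) hsame ?_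
  rw [← hva]
  exact axisVector_injective.ne hk

theorem IsDiagonalOn.autGroupAt_le_octahedralGroup (h : IsDiagonalOn L S)
    (hcard : 2 < S.card) (hp : p ∈ S) (σ : StabSection L) : autGroupAt σ p ≤ octahedralGroup := by
  classical
  rintro _ ⟨g, hg, rfl⟩
  obtain ⟨q, hq, r, hr, hqr⟩ : ∃ q ∈ S.erase p, ∃ r ∈ S.erase p, q ≠ r := by
    rw [← Finset.one_lt_card, Finset.card_erase_of_mem hp]
    omega
  rw [Finset.mem_erase] at hq hr
  obtain ⟨c, hcL, hσ⟩ := σ.exists_opMatrix_projector_eq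
  have hc := piKronecker_pauliRotation_mulVec_eq hσ hg
  refine mem_octahedralGroup_of_isColumnMonomial fun i j k hi hj => axisVector_injective ?_
  change (g p).1 i k ≠ 0 at hi
  change (g p).1 j k ≠ 0 at hj
  rw [← pauliRotation_axisVector] at hi hj
  obtain ⟨v, hv, hvp⟩ := h.exists_apply_eq hp (axisVector i)
  obtain ⟨v', hv', hvp'⟩ := h.exists_apply_eq hp (axisVector j)
  obtain ⟨w, hw, hwp⟩ := h.exists_apply_eq hp (axisVector k)
  rw [← hwp, ← hvp] at hi
  rw [← hwp, ← hvp'] at hj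
  rw [← hvp, ← hvp', h.eq_of_pauliRotation_ne_zero hc hcL hp hq.2 hr.2 hq.1 hr.1 hqr hv hv' hw
    hi hj]

end Automorphisms

section Plane

/-- The symplectic form of the plane `V`, of which `omega` is the sum over the factors. -/
def planeForm (a b : V) : ZMod 2 :=
  a.1 * b.2 - a.2 * b.1

theorem planeForm_zero_left (b : V) : planeForm 0 b = 0 := by
  simp [planeForm]

theorem planeForm_zero_right (a : V) : planeForm a 0 = 0 := by
  simp [planeForm]

theorem planeForm_eq_one {a b : V} (ha : a ≠ 0) (hb : b ≠ 0) (hab : a ≠ b) :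
    planeForm a b = 1 := by
  revert a b
  decide

theorem eq_zero_of_forall_planeForm_eq_zero {a : V} (h : ∀ b, planeForm a b = 0) : a = 0 := by
  revert a
  decide

theorem eq_zero_or_eq_or_eq_or_eq_add {a b : V} (ha : a ≠ 0) (hb : b ≠ 0) (hab : a ≠ b) (x : V) :
    x = 0 ∨ x = a ∨ x = b ∨ x = a + b := by
  revert a b x
  decide

end Plane

section Symplectic

variable {P : Type*} {L : Submodule (ZMod 2) (P → V)} {S : Finset P}

namespace IsDiagonalOn

theorem isIndecomposableOn [DecidableEq P] (h : IsDiagonalOn L S) :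
    IsIndecomposableOn S (restrict L S) := by
  have hbot (T : Finset P) (s : P) (hs : s ∈ S) (hsT : s ∉ T) : restrict (restrict L S) T = ⊥ :=
    (Submodule.eq_bot_iff _).2 fun u hu => by_contra fun hu0 =>
      h.apply_ne_zero hu.1 hu0 hs (hu.2 s hsT)
  rintro T hTS ⟨t, ht⟩ hne heq
  obtain ⟨s, hs, hsT⟩ := Finset.exists_of_ssubset (hTS.ssubset_of_ne hne)
  obtain ⟨a, ha⟩ := exists_ne (0 : V)
  obtain ⟨v, hv, hvt⟩ := h.exists_apply_eq (hTS ht) a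
  rw [hbot T s hs hsT, hbot (S \ T) t (hTS ht) (fun h => (Finset.mem_sdiff.1 h).2 ht), sup_bot_eq]
    at heq
  rw [heq, Submodule.mem_bot] at hv
  exact ha (hvt.symm.trans (congrFun hv t))

theorem finrank_restrict (h : IsDiagonalOn L S) {p : P} (hp : p ∈ S) :
    Module.finrank (ZMod 2) (restrict L S) = 2 := by
  let e : restrict L S →ₗ[ZMod 2] V := LinearMap.proj p ∘ₗ (restrict L S).subtype
  rw [(LinearEquiv.ofBijective e (h p hp)).finrank_eq, Module.finrank_prod, Module.finrank_self]

end IsDiagonalOn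

variable [Fintype P]

theorem omega_eq_sum_planeForm {v w : P → V} (h : ∀ s ∉ S, v s = 0 ∨ w s = 0) :
    omega v w = ∑ s ∈ S, planeForm (v s) (w s) := by
  refine (Finset.sum_subset S.subset_univ fun s _ hs => ?_).symm
  obtain h | h := h s hs <;> rw [h]
  exacts [planeForm_zero_left _, planeForm_zero_right _]

namespace IsDiagonalOn

theorem even_card (h : IsDiagonalOn L S) (hL : IsIsotropic L) : Even S.card := by
  obtain rfl | ⟨p, hp⟩ := S.eq_empty_or_nonempty
  · exact Even.zero
  obtain ⟨v, hv, hvp⟩ := h.exists_apply_eq hp (1, 0)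
  obtain ⟨w, hw, hwp⟩ := h.exists_apply_eq hp (0, 1)
  have hv0 : v ≠ 0 := ne_of_apply_ne (fun x => x p) (by simp [hvp])
  have hw0 : w ≠ 0 := ne_of_apply_ne (fun x => x p) (by simp [hwp])
  have hvw : v ≠ w := ne_of_apply_ne (fun x => x p) (by simp [hvp, hwp])
  have hform (s : P) (hs : s ∈ S) : planeForm (v s) (w s) = 1 :=
    planeForm_eq_one (h.apply_ne_zero hv hv0 hs) (h.apply_ne_zero hw hw0 hs)
      fun hsvw => hvw (h.eq_of_apply_eq hs hv hw hsvw)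
  have hsum := hL v hv.1 w hw.1
  rwa [omega_eq_sum_planeForm fun s hs => .inl (hv.2 s hs), Finset.sum_congr rfl hform,
    Finset.sum_const, nsmul_one, ZMod.natCast_eq_zero_iff_even] at hsum

variable [DecidableEq P]

theorem isBellOn_of_card_eq_two (h : IsDiagonalOn L S) (hL : IsIsotropic L) (hcard : S.card = 2) :
    IsBellOn S (restrict L S) := by
  obtain ⟨p, hp⟩ := Finset.card_pos.1 (hcard ▸ two_pos)
  exact ⟨hcard, ⟨inf_le_right, fun a ha b hb => hL a ha.1 b hb.1,
    (h.finrank_restrict hp).trans hcard.symm⟩, h.isIndecomposableOn⟩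

/-- If `u ∈ L` and `m ∈ L_S` agree at one point of `S`, then `u - m` is orthogonal to `L_S` at the
other one, and `L_S` projects onto `V` there. -/
theorem splitsAt_of_card_eq_two (h : IsDiagonalOn L S) (hL : IsIsotropic L) (hcard : S.card = 2) :
    SplitsAt L S := by
  obtain ⟨p, q, -, rfl⟩ := Finset.card_eq_two.1 hcard
  refine le_antisymm (fun u hu => ?_) (sup_le inf_le_left inf_le_left)
  obtain ⟨m, hm, hmp⟩ := h.exists_apply_eq (Finset.mem_insert_self p {q}) (u p)
  have hdL : u - m ∈ L := sub_mem hu hm.1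
  have hdp : (u - m) p = 0 := by simp [hmp]
  have hdq : (u - m) q = 0 := eq_zero_of_forall_planeForm_eq_zero fun b => by
    obtain ⟨w, hw, rfl⟩ := h.exists_apply_eq (Finset.mem_insert_of_mem
      (Finset.mem_singleton_self q)) b
    have hzero (s : P) (hs : s ∉ ({q} : Finset P)) : (u - m) s = 0 ∨ w s = 0 := by
      obtain rfl | hsp := eq_or_ne s p
      · exact .inl hdp
      · exact .inr (hw.2 s (by simp_all))
    simpa [omega_eq_sum_planeForm hzero] using hL _ hdL w hw.1
  refine Submodule.mem_sup.2 ⟨m, hm, u - m, ⟨hdL, fun s hs => ?_⟩, add_sub_cancel _ _⟩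
  obtain rfl | rfl : s = p ∨ s = q := by simpa [imp_iff_not_or] using hs
  exacts [hdp, hdq]

end IsDiagonalOn

end Symplectic

section MinimalSupport

variable {P : Type*} {L : Submodule (ZMod 2) (P → V)} {S : Finset P} {p : P}

theorem apply_ne_zero_of_minimal
    (hmin : ∀ u ∈ restrict L S, u p ≠ 0 → ∀ s ∈ S, u s ≠ 0) {v w : P → V}
    (hv : v ∈ restrict L S) (hw : w ∈ restrict L S) (hvp : v p ≠ 0) (hwp : w p ≠ 0)
    (hvw : v p ≠ w p) {u : P → V} (hu : u ∈ restrict L S) (hu0 : u ≠ 0) {s : P} (hs : s ∈ S) :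
    u s ≠ 0 := by
  suffices hup : u p ≠ 0 from hmin u hu hup s hs
  intro hup
  obtain ⟨t, ht⟩ := ne_iff.1 hu0
  have htS : t ∈ S := by_contra fun h => ht (hu.2 t h)
  have hne {x : P → V} (hx : x ∈ restrict L S) (hxp : x p ≠ 0) : u t ≠ x t := fun h =>
    hmin (u - x) (sub_mem hu hx) (by simpa [hup] using hxp) t htS (sub_eq_zero.2 h)
  have hsub : (v - w) p ≠ 0 := sub_ne_zero.2 hvw
  have hvwt : v t ≠ w t := sub_ne_zero.1 (hmin _ (sub_mem hv hw) hsub t htS)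
  rcases eq_zero_or_eq_or_eq_or_eq_add (hmin v hv hvp t htS) (hmin w hw hwp t htS) hvwt (u t) with
    h | h | h | h
  · exact ht h
  · exact hne hv hvp h
  · exact hne hw hwp h
  · exact hne (sub_mem hv hw) hsub (h.trans (ZModModule.sub_eq_add _ _).symm)

theorem exists_apply_eq_of_ne {v w : P → V} {s : P} (hv : v ∈ L) (hw : w ∈ L) (hvs : v s ≠ 0)
    (hws : w s ≠ 0) (hvw : v s ≠ w s) (α : V) : ∃ u ∈ L, u s = α := by
  obtain rfl | rfl | rfl | rfl := eq_zero_or_eq_or_eq_or_eq_add hvs hws hvw α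
  exacts [⟨0, zero_mem L, rfl⟩, ⟨v, hv, rfl⟩, ⟨w, hw, rfl⟩, ⟨v + w, add_mem hv hw, rfl⟩]

theorem isDiagonalOn_of_minimal (hmin : ∀ u ∈ restrict L S, u p ≠ 0 → ∀ s ∈ S, u s ≠ 0)
    {v w : P → V} (hv : v ∈ restrict L S) (hw : w ∈ restrict L S) (hvp : v p ≠ 0) (hwp : w p ≠ 0)
    (hvw : v p ≠ w p) : IsDiagonalOn L S := by
  have hfull {u : P → V} (hu : u ∈ restrict L S) (hu0 : u ≠ 0) {s : P} (hs : s ∈ S) : u s ≠ 0 :=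
    apply_ne_zero_of_minimal hmin hv hw hvp hwp hvw hu hu0 hs
  refine fun s hs => ⟨fun a b hab => ?_, fun α => ?_⟩
  · by_contra hne
    exact hfull (sub_mem a.2 b.2) (sub_ne_zero.2 (Subtype.coe_injective.ne hne)) hs
      (sub_eq_zero.2 hab)
  · have hvws : (v - w) s ≠ 0 :=
      hfull (sub_mem hv hw) (sub_ne_zero.2 fun h => hvw (congrFun h p)) hs
    obtain ⟨u, hu, hus⟩ := exists_apply_eq_of_ne hv hw (hmin v hv hvp s hs) (hmin w hw hwp s hs)
      (sub_ne_zero.1 hvws) α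
    exact ⟨⟨u, hu⟩, hus⟩

theorem exists_forall_apply_eq_or_isDiagonalOn [Finite P] (hp : ∃ v ∈ L, v p ≠ 0) :
    (∃ v ∈ L, v p ≠ 0 ∧ ∀ w ∈ L, support w = support v → w p = v p) ∨
      ∃ S : Finset P, p ∈ S ∧ IsDiagonalOn L S := by
  obtain ⟨v, ⟨hv, hvp⟩, hmin⟩ :=
    exists_minimalFor_of_wellFoundedLT (fun v => v ∈ L ∧ v p ≠ 0) support hp
  by_cases! hsame : ∀ w ∈ L, support w = support v → w p = v p
  · exact .inl ⟨v, hv, hvp, hsame⟩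
  obtain ⟨w, hw, hwv, hne⟩ := hsame
  obtain ⟨S, hS⟩ := (support v).toFinite.exists_finset_coe
  have hmem (s : P) : s ∈ S ↔ v s ≠ 0 := by rw [← Finset.mem_coe, hS, mem_support]
  have hrestrict {u : P → V} (hu : u ∈ L) (huv : support u = support v) : u ∈ restrict L S :=
    ⟨hu, fun s hs => notMem_support.1 (by rwa [huv, ← hS])⟩
  have hfull (u : P → V) (hu : u ∈ restrict L S) (hup : u p ≠ 0) (s : P) (hs : s ∈ S) :
      u s ≠ 0 := by
    have hle : support u ⊆ support v := fun t ht =>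
      (hmem t).1 (by_contra fun htS => ht (hu.2 t htS))
    exact hmin ⟨hu.1, hup⟩ hle ((hmem s).1 hs)
  have hwp : w p ≠ 0 := by rwa [← mem_support, hwv]
  exact .inr ⟨S, (hmem p).2 hvp,
    isDiagonalOn_of_minimal hfull (hrestrict hv rfl) (hrestrict hw hwv) hvp hwp hne.symm⟩

end MinimalSupport

section ZeroFactor

variable {P : Type*} [Fintype P] [DecidableEq P] {L : Submodule (ZMod 2) (P → V)}

theorem exists_mem_apply_ne_zero (h : ¬SplitsOffZero L) (p : P) : ∃ v ∈ L, v p ≠ 0 := by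
  contrapose! h
  have hcompl : L ≤ restrict L {p}ᶜ := fun v hv =>
    ⟨hv, fun s hs => (show s = p by simpa using hs) ▸ h v hv⟩
  refine ⟨{p}, Finset.singleton_nonempty p,
    le_antisymm (hcompl.trans le_sup_right) (sup_le inf_le_left inf_le_left), ?_⟩
  refine (Submodule.eq_bot_iff _).2 fun v hv => funext fun s => ?_
  obtain rfl | hs := eq_or_ne s p
  · exact h v hv.1
  · exact hv.2 s (by simpa using hs)

end ZeroFactor

end StabilizerCode

open StabilizerCode in
theorem mainTheorem1_general {P : Type*} [Fintype P] [DecidableEq P]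
    {L : Submodule (ZMod 2) (P → V)} (hL : IsIsotropic L) {p : P} (hp : ∃ v ∈ L, v p ≠ 0)
    (hbell : ∀ S, p ∈ S → SplitsAt L S → ¬IsBellOn S (restrict L S)) :
    (∀ σ : StabSection L, autGroupAt σ p ≤ octahedralGroup) ∨
      ∃ a : Fin 3, ∀ σ : StabSection L, autGroupAt σ p ≤ dihedralGroup a := by
  rcases exists_forall_apply_eq_or_isDiagonalOn hp with ⟨v, hv, hvp, hsame⟩ | ⟨S, hpS, hS⟩
  · obtain ⟨a, ha⟩ := exists_axisVector_eq hvp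
    exact .inr ⟨a, autGroupAt_le_dihedralGroup hv ha hsame⟩
  · have hcard : S.card ≠ 2 := fun h =>
      hbell S hpS (hS.splitsAt_of_card_eq_two hL h) (hS.isBellOn_of_card_eq_two hL h)
    have hpos : 0 < S.card := Finset.card_pos.2 ⟨p, hpS⟩
    obtain ⟨k, hk⟩ := hS.even_card hL
    exact .inl (hS.autGroupAt_le_octahedralGroup (by omega) hpS)

theorem mainTheorem1 {P : Type*} [Fintype P] [DecidableEq P]
    (L : Submodule (ZMod 2) (P → StabilizerCode.V))
    (hL : StabilizerCode.IsIsotropic L)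
    (hzero : ¬ StabilizerCode.SplitsOffZero L)
    (hbell : ¬ StabilizerCode.SplitsOffBell L)
    (p : P) :
    (∀ σ : StabilizerCode.StabSection L,
        StabilizerCode.autGroupAt σ p ≤ StabilizerCode.octahedralGroup) ∨
      ∃ a : Fin 3, ∀ σ : StabilizerCode.StabSection L,
        StabilizerCode.autGroupAt σ p ≤ StabilizerCode.dihedralGroup a :=
  mainTheorem1_general hL (StabilizerCode.exists_mem_apply_ne_zero hzero p)
    fun S _ hS hbellS => hbell ⟨S, hS, hbellS⟩
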